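/- For a function $x\colon V\to\mathbb C$ on a finite set $V$ write $\|x\|_\infty=\max_{v\in V}|x(v)|$, $\|x\|_2=\bigl(\frac1{|V|}\sum_{v\in V}|x(v)|^2\bigr)^{1/2}$ and $\langle x,y\rangle=\frac1{|V|}\sum_{v\in V}\overline{x(v)}\,y(v)$. A Cayley graph is given by a finite group $G$ and a generating set $S=S^{-1}$ of $G$ not containing the identity; its vertex set is $G$ and its (unweighted, undirected) edges are the pairs $\{g,sg\}$ with $g\in G$, $s\in S$. There is an absolute constant $c>0$ such that, for infinitely many positive integers $n$, there exist an $n$-vertex Cayley graph and an eigenvalue of its adjacency matrix such that every function $x\colon G\to\mathbb C$ in the corresponding (nonzero) eigenspace satisfies $$\|x\|_\infty\ \ge\ c\,\|x\|_2\,\frac{\sqrt{\log n}}{\log\log n}.$$ Consequently, bounded eigenbases fail in general: for every real $C$ there is a Cayley graph whose adjacency matrix has no basis of eigenfunctions that is orthonormal for $\langle\cdot,\cdot\rangle$ and all of whose elements $x$ satisfy $\|x\|_\infty\le C$. -/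

import Mathlib

/-- A symmetric generating set of the group `Γ` not containing the identity. -/
structure SymmGenSet (Γ : Type) [Group Γ] where
  carrier : Set Γ
  one_notMem : (1 : Γ) ∉ carrier
  inv_mem : ∀ s ∈ carrier, s⁻¹ ∈ carrier
  closure_eq_top : Subgroup.closure carrier = ⊤

/-- The undirected, unweighted Cayley graph on `Γ` with generating set `S`:
its edges are the pairs `(g, s * g)` with `g ∈ Γ` and `s ∈ S`. -/
def SymmGenSet.cayleyGraph {Γ : Type} [Group Γ] (S : SymmGenSet Γ) : SimpleGraph Γ where
  Adj g h := ∃ s ∈ S.carrier, h = s * g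
  symm := ⟨by
    rintro g h ⟨s, hs, rfl⟩
    exact ⟨s⁻¹, S.inv_mem s hs, by simp⟩⟩
  loopless := ⟨by
    rintro g ⟨s, hs, h⟩
    have h1 : s = 1 := by simpa using h.symm
    exact S.one_notMem (h1 ▸ hs)⟩

open Classical in
/-- The adjacency matrix of a finite graph, acting on complex functions on its vertices. -/
noncomputable def adjOp {V : Type} [Fintype V] (H : SimpleGraph V) : Module.End ℂ (V → ℂ) :=
  Matrix.toLin' (H.adjMatrix ℂ)

/-- The `L^∞` norm of a function on a finite set. -/
noncomputable def normLinf {V : Type} (x : V → ℂ) : ℝ := ⨆ v, ‖x v‖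

/-- The `L²` norm of a function on a finite set, with respect to the averaging measure. -/
noncomputable def normL2 {V : Type} [Fintype V] (x : V → ℂ) : ℝ :=
  Real.sqrt ((∑ v, ‖x v‖ ^ 2) / Fintype.card V)

/-- The Hermitian inner product of functions on a finite set, with respect to the averaging
measure. -/
noncomputable def avgInner {V : Type} [Fintype V] (x y : V → ℂ) : ℂ :=
  (∑ v, star (x v) * y v) / Fintype.card V

/-- `H` has a unitary eigenbasis (for its adjacency matrix) all of whose elements are
`C`-bounded. -/
def HasBoundedEigenbasis {V : Type} [Fintype V] (H : SimpleGraph V) (C : ℝ) : Prop :=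
  ∃ b : Module.Basis V ℂ (V → ℂ),
    (∀ i, avgInner (b i) (b i) = 1) ∧
    (∀ i j, i ≠ j → avgInner (b i) (b j) = 0) ∧
    (∀ i, ∃ μ : ℂ, (adjOp H).HasEigenvector μ (b i)) ∧
    ∀ i, normLinf (b i) ≤ C

/-! Let `G` be the group of signed permutations of `d` coordinates, and `v` an integer vector with
`v k` about `√(d/(k+1))`. The functions `g ↦ ⟨g⁻¹v, w⟩` form the space that is to become an
eigenspace. A vector sorted in decreasing absolute value has `|w k| ≤ ‖w‖/√(k+1)`, which makes `v`
correlate with it: some signed permutation gives `⟨g⁻¹v, w⟩ ≥ √d ‖w‖` for real `w`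
(`exists_sqrt_mul_le_sum_orbit`). By Schur-type orthogonality the mean square of the function is
only `‖v‖²‖w‖²/d`, at most `4(1 + log d)‖w‖²`. So every function in the space has sup norm at least
of order `√(d/log d)` times its `L²` norm.

This space is the eigenspace of a weighted Cayley operator: the weights `b h = B + ⟨h⁻¹v, v⟩` give
the kernel `b (h g⁻¹) = B + ⟨h⁻¹v, g⁻¹v⟩`, of rank at most `d + 1`, whose constant part has a
different eigenvalue (`exists_eq_sum_frame_mul`).

To remove the weights, pass to `G × 𝔽_p²` and replace the weight `b h` by `b h` punctured lines
through the origin. On functions pulled back from `G` this acts with weights `(p - 1) b h`. A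
nontrivial character of the plane is trivial on at most one line, so its sum over the fibre is at
most `p` in modulus (`norm_sum_lineUnion_le`), too small to produce the eigenvalue `(p - 1) κ`.

With `p` of order `d²`, `log n` lies between `d` and a multiple of `d log d`, which turns `√(d/log
d)` into the stated bound. -/

open Classical in
lemma adjOp_cayleyGraph_apply {Γ : Type} [Group Γ] [Fintype Γ] (S : SymmGenSet Γ)
    (x : Γ → ℂ) (g : Γ) :
    adjOp S.cayleyGraph x g = ∑ s, if s ∈ S.carrier then x (s * g) else 0 := by
  rw [adjOp, Matrix.toLin'_apply, Matrix.mulVec, dotProduct, ← Equiv.sum_comp (Equiv.mulRight g)]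
  refine Finset.sum_congr rfl fun s _ => ?_
  rw [SimpleGraph.adjMatrix_apply, ite_mul, one_mul, zero_mul, Equiv.coe_mulRight]
  refine if_congr ?_ rfl rfl
  simp [SymmGenSet.cayleyGraph]

/-- A weighted translation operator with small weights has no large eigenvalue. -/
lemma eq_zero_of_sum_mul_translate_eq {G : Type} [Group G] [Fintype G] {c : G → ℂ} {M : ℝ} {μ : ℂ}
    (hc : ∀ h, ‖c h‖ ≤ M) (hμ : Fintype.card G * M < ‖μ‖) {y : G → ℂ}
    (hy : ∀ g, ∑ h, c h * y (h * g) = μ * y g) (g : G) : y g = 0 := by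
  -- Maximum principle: at a point `a` where `‖y‖` is largest, the equation bounds `‖μ‖ ‖y a‖` by
  -- `|G| M ‖y a‖`.
  obtain ⟨a, -, ha⟩ := Finset.exists_max_image Finset.univ (fun g => ‖y g‖) ⟨1, Finset.mem_univ _⟩
  have hM : ‖μ‖ * ‖y a‖ ≤ Fintype.card G * M * ‖y a‖ := by
    rw [← norm_mul, ← hy a]
    calc ‖∑ h, c h * y (h * a)‖ ≤ ∑ h : G, M * ‖y a‖ := by
          refine norm_sum_le_of_le _ fun h _ => ?_
          rw [norm_mul]
          exact mul_le_mul (hc h) (ha _ (Finset.mem_univ _)) (norm_nonneg _)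
            ((norm_nonneg _).trans (hc h))
      _ = _ := by simp [mul_assoc]
  have ha0 : ‖y a‖ = 0 := by
    by_contra hne
    have : 0 < ‖y a‖ := lt_of_le_of_ne (norm_nonneg _) (Ne.symm hne)
    nlinarith
  have := ha g (Finset.mem_univ _)
  rw [ha0] at this
  simpa using this

/-! ### Character sums over lines in the plane `𝔽_p²` -/

/-- The union of the first `b` lines `{(t, j t)}` through the origin of the plane over `ZMod p`,
with the origin removed. -/
def lineUnion (p b : ℕ) [Fact p.Prime] : Finset (ZMod p × ZMod p) :=
  Finset.univ.filter fun k => k.1 ≠ 0 ∧ (k.2 / k.1).val < b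

lemma mem_lineUnion {p b : ℕ} [Fact p.Prime] {k : ZMod p × ZMod p} :
    k ∈ lineUnion p b ↔ k.1 ≠ 0 ∧ (k.2 / k.1).val < b := by
  simp [lineUnion]

lemma neg_mem_lineUnion {p b : ℕ} [Fact p.Prime] {k : ZMod p × ZMod p}
    (hk : k ∈ lineUnion p b) : -k ∈ lineUnion p b := by
  simpa [mem_lineUnion, neg_div_neg_eq] using hk

/-- Slope and first coordinate parametrise the punctured lines, which are disjoint. -/
lemma sum_lineUnion {p b : ℕ} [Fact p.Prime] (F : ZMod p × ZMod p → ℂ) :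
    ∑ k ∈ lineUnion p b, F k =
      ∑ j with ZMod.val (n := p) j < b, (∑ t : ZMod p, F (t, j * t) - F 0) := by
  have h1 : ∀ j : ZMod p, ∑ t : ZMod p, F (t, j * t) - F 0 =
      ∑ t ∈ Finset.univ.erase 0, F (t, j * t) := by
    intro j
    rw [← Finset.sum_erase_add _ _ (Finset.mem_univ 0)]
    simp [← Prod.zero_eq_mk]
  rw [Finset.sum_congr rfl fun j _ => h1 j, ← Finset.sum_product']
  refine Finset.sum_nbij' (fun k => (k.2 / k.1, k.1)) (fun q => (q.2, q.1 * q.2)) ?_ ?_ ?_ ?_ ?_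
  · intro k hk
    simpa [mem_lineUnion, and_comm] using hk
  · rintro ⟨j, t⟩ h
    simp only [Finset.mem_product, Finset.mem_filter, Finset.mem_univ, true_and,
      Finset.mem_erase, and_true] at h
    simp [mem_lineUnion, h.1, h.2]
  · intro k hk
    rw [mem_lineUnion] at hk
    ext <;> simp [hk.1]
  · rintro ⟨j, t⟩ h
    simp only [Finset.mem_product, Finset.mem_filter, Finset.mem_univ, true_and,
      Finset.mem_erase, and_true] at h
    simp [h.2]
  · intro k hk
    rw [mem_lineUnion] at hk
    simp [hk.1]

lemma card_filter_zmod_val_lt {p b : ℕ} [NeZero p] (hb : b ≤ p) :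
    (Finset.univ.filter fun j : ZMod p => j.val < b).card = b := by
  conv_rhs => rw [← Finset.card_range b]
  refine Finset.card_nbij' (fun j => j.val) (fun i => (i : ZMod p)) ?_ ?_ ?_ ?_
  · intro j hj; simpa using hj
  · intro i hi
    have hi' : i < b := by simpa using hi
    simpa [ZMod.val_natCast_of_lt (hi'.trans_le hb)] using hi'
  · intro j _; simp
  · intro i hi
    have hi' : i < b := by simpa using hi
    exact ZMod.val_natCast_of_lt (hi'.trans_le hb)

lemma card_lineUnion {p b : ℕ} [Fact p.Prime] (hb : b ≤ p) :
    ((lineUnion p b).card : ℂ) = (p - 1) * b := by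
  have := sum_lineUnion (p := p) (b := b) fun _ => 1
  simp only [Finset.sum_const, nsmul_eq_mul, mul_one, Finset.card_univ, ZMod.card,
    card_filter_zmod_val_lt hb] at this
  rw [this, mul_comm]

/-- A full line contributes `p` if `ψ` is trivial on it and `0` otherwise. Two distinct lines span
the plane, so `ψ ≠ 0` is trivial on at most one of them; the sum is therefore `-b` or `p - b`. -/
lemma norm_sum_lineUnion_le {p b : ℕ} [Fact p.Prime] (hb : b ≤ p)
    {ψ : AddChar (ZMod p × ZMod p) ℂ} (hψ : ψ ≠ 0) :
    ‖∑ k ∈ lineUnion p b, ψ k‖ ≤ p := by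
  classical
  let χ : ZMod p → AddChar (ZMod p) ℂ := fun j =>
    ψ.compAddMonoidHom ((AddMonoidHom.id _).prod (AddMonoidHom.mulLeft j))
  have hχ : ∀ j t, χ j t = ψ (t, j * t) := fun j t => rfl
  have hinj : ∀ i j, χ i = 0 → χ j = 0 → i = j := by
    intro i j hi hj
    by_contra hne
    apply hψ
    have hd : i - j ≠ 0 := sub_ne_zero.2 hne
    ext ⟨a, c⟩
    -- First coordinate of the component of `(a, c)` along the line of slope `i`, in the splitting
    -- of the plane by slopes `i` and `j`.
    set t := (c - j * a) / (i - j)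
    have e : ((a, c) : ZMod p × ZMod p) = (t, i * t) + (a - t, j * (a - t)) := by
      have : c = i * t + j * (a - t) := by
        have : (i - j) * t = c - j * a := by simp only [t]; field_simp
        linear_combination -this
      ext <;> simp [← this]
    rw [e, AddChar.map_add_eq_mul, ← hχ, ← hχ, hi, hj]
    simp
  rw [sum_lineUnion, AddChar.map_zero_eq_one]
  set J := Finset.univ.filter fun j : ZMod p => j.val < b
  have hJ : J.card = b := card_filter_zmod_val_lt hb
  have hsum : ∑ j ∈ J, (∑ t, ψ (t, j * t) - 1) =
      (((p : ℝ) * (J.filter fun j => χ j = 0).card - b : ℝ) : ℂ) := by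
    rw [Finset.sum_sub_distrib]
    have : ∀ j, ∑ t, ψ (t, j * t) = if χ j = 0 then (p : ℂ) else 0 := by
      intro j
      have := AddChar.sum_eq_ite (χ j)
      simpa [hχ, ZMod.card] using this
    rw [Finset.sum_congr rfl fun j _ => this j, ← Finset.sum_filter]
    simp [hJ, mul_comm]
  have hcard : (J.filter fun j => χ j = 0).card ≤ 1 := by
    rw [Finset.card_le_one]
    intro i hi j hj
    exact hinj i j (Finset.mem_filter.1 hi).2 (Finset.mem_filter.1 hj).2
  rw [hsum, Complex.norm_real, Real.norm_eq_abs, abs_le]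
  have h1 : ((J.filter fun j => χ j = 0).card : ℝ) ≤ 1 := by exact_mod_cast hcard
  have h2 : (b : ℝ) ≤ p := by exact_mod_cast hb
  have h3 : (0 : ℝ) ≤ (J.filter fun j => χ j = 0).card := by positivity
  have h4 : (0 : ℝ) ≤ p := by positivity
  constructor <;> nlinarith

/-! ### Fourier analysis in the abelian factor -/

/-- The partial Fourier transform, in the second variable, of an eigenfunction of the sum of
translations by `(h, t)` with `t ∈ T h`. -/
lemma sum_fourier_mul_translate {G K : Type} [Group G] [Fintype G] [AddCommGroup K] [Fintype K]
    {T : G → Finset K} {μ : ℂ} {x : G → K → ℂ}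
    (hx : ∀ g k, ∑ h, ∑ t ∈ T h, x (h * g) (t + k) = μ * x g k) (ψ : AddChar K ℂ) (g : G) :
    ∑ h, (∑ t ∈ T h, ψ (-t)) * ∑ k, ψ k * x (h * g) k = μ * ∑ k, ψ k * x g k := by
  calc ∑ h, (∑ t ∈ T h, ψ (-t)) * ∑ k, ψ k * x (h * g) k
      = ∑ h, ∑ t ∈ T h, ∑ k, ψ k * x (h * g) (t + k) := by
        refine Finset.sum_congr rfl fun h _ => ?_
        rw [Finset.sum_mul]
        refine Finset.sum_congr rfl fun t _ => ?_
        rw [Finset.mul_sum, ← Equiv.sum_comp (Equiv.addLeft t)]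
        refine Finset.sum_congr rfl fun k _ => ?_
        rw [Equiv.coe_addLeft, ← mul_assoc, ← AddChar.map_add_eq_mul, neg_add_cancel_left]
    _ = ∑ k, ∑ h, ∑ t ∈ T h, ψ k * x (h * g) (t + k) := by
        rw [Finset.sum_comm]
        exact Finset.sum_congr rfl fun h _ => Finset.sum_comm
    _ = μ * ∑ k, ψ k * x g k := by
        rw [Finset.mul_sum]
        refine Finset.sum_congr rfl fun k _ => ?_
        simp_rw [← Finset.mul_sum, hx]
        ring

/-- Fourier inversion: only the trivial character survives, so `y` is constant. -/
lemma card_mul_eq_sum_of_fourier_eq_zero {K : Type} [AddCommGroup K] [Fintype K] {y : K → ℂ}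
    (hy : ∀ ψ : AddChar K ℂ, ψ ≠ 0 → ∑ k, ψ k * y k = 0) (k : K) :
    Fintype.card K * y k = ∑ l, y l := by
  classical
  have h1 : ∑ ψ : AddChar K ℂ, ψ (-k) * ∑ l, ψ l * y l = ∑ l, y l := by
    rw [Finset.sum_eq_single 0]
    · simp
    · intro ψ _ h; rw [hy ψ h, mul_zero]
    · simp
  rw [← h1]
  simp_rw [Finset.mul_sum, ← mul_assoc, ← AddChar.map_add_eq_mul]
  rw [Finset.sum_comm]
  simp_rw [← Finset.sum_mul, AddChar.sum_apply_eq_ite]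
  rw [Finset.sum_eq_single k]
  · simp
  · intro l _ h
    rw [if_neg, zero_mul]
    rw [neg_add_eq_zero]; exact fun e => h e.symm
  · simp

/-! ### From weights on `G` to an unweighted Cayley graph on `G × 𝔽_p²` -/

section PlaneExtension

variable {G : Type} [Group G] {p : ℕ} [Fact p.Prime]

/-- The generating set of `G × 𝔽_p²` whose fibre over `h` is a union of `b h` lines without the
origin. -/
def planeGenSet (p : ℕ) [Fact p.Prime] (b : G → ℕ) (hb : ∀ h, 2 ≤ b h)
    (hinv : ∀ h, b h⁻¹ = b h) : SymmGenSet (G × Multiplicative (ZMod p × ZMod p)) where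
  carrier := {s | s.2.toAdd ∈ lineUnion p (b s.1)}
  one_notMem := by simp [mem_lineUnion]
  inv_mem := by
    intro s hs
    simpa [hinv] using neg_mem_lineUnion hs
  closure_eq_top := by
    have : Fact (1 < p) := ⟨(Fact.out : p.Prime).one_lt⟩
    rw [eq_top_iff]
    set H := Subgroup.closure
      {s : G × Multiplicative (ZMod p × ZMod p) | s.2.toAdd ∈ lineUnion p (b s.1)} with hH
    have hline : ∀ h (t j : ZMod p), t ≠ 0 → j.val < 2 →
        ((h, Multiplicative.ofAdd (t, j * t)) : G × Multiplicative (ZMod p × ZMod p)) ∈ H := by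
      intro h t j ht hj
      refine Subgroup.subset_closure ?_
      simpa [mem_lineUnion, ht] using hj.trans_le (hb h)
    have hline1 : ∀ t j : ZMod p, j.val < 2 →
        ((1, Multiplicative.ofAdd (t, j * t)) : G × Multiplicative (ZMod p × ZMod p)) ∈ H := by
      intro t j hj
      rcases eq_or_ne t 0 with rfl | ht
      · rw [mul_zero]
        exact H.one_mem
      · exact hline 1 t j ht hj
    -- The lines of slopes 0 and 1, present in every fibre since `2 ≤ b h`, already span the plane:
    -- `(a, c) = (a - c, 0) + (c, c)`.
    have hplane : ∀ a c : ZMod p,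
        ((1, Multiplicative.ofAdd (a, c)) : G × Multiplicative (ZMod p × ZMod p)) ∈ H := by
      intro a c
      have := H.mul_mem (hline1 (a - c) 0 (by simp)) (hline1 c 1 (by simp [ZMod.val_one]))
      simpa [← ofAdd_add] using this
    rintro ⟨h, k⟩ -
    have := H.mul_mem (hline h 1 0 one_ne_zero (by simp))
      (hplane (k.toAdd.1 - 1) k.toAdd.2)
    have e : ((1 : ZMod p), 0 * (1 : ZMod p)) + (k.toAdd.1 - 1, k.toAdd.2) = k.toAdd := by
      ext <;> simp
    rw [Prod.mk_mul_mk, ← ofAdd_add, e] at this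
    simpa using this

variable [Fintype G] {b : G → ℕ} {hb : ∀ h, 2 ≤ b h} {hinv : ∀ h, b h⁻¹ = b h}

lemma adjOp_planeGenSet_apply (x : G × Multiplicative (ZMod p × ZMod p) → ℂ) (g : G)
    (k : ZMod p × ZMod p) :
    adjOp (planeGenSet p b hb hinv).cayleyGraph x (g, .ofAdd k) =
      ∑ h, ∑ t ∈ lineUnion p (b h), x (h * g, .ofAdd (t + k)) := by
  classical
  rw [adjOp_cayleyGraph_apply, Fintype.sum_prod_type]
  refine Finset.sum_congr rfl fun h _ => ?_
  rw [← Equiv.sum_comp (Multiplicative.ofAdd : ZMod p × ZMod p ≃ _), ← Finset.sum_filter]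
  refine Finset.sum_congr ?_ fun t _ => ?_
  · ext t
    simp only [Finset.mem_filter, Finset.mem_univ, true_and]
    exact Iff.rfl
  · simp [← ofAdd_add]

/-- Eigenfunctions for large eigenvalues are pulled back from `G`. -/
lemma exists_eq_of_adjOp_planeGenSet_eq (hbp : ∀ h, b h ≤ p) {μ : ℂ}
    (hμ : Fintype.card G * (p : ℝ) < ‖μ‖) {x : G × Multiplicative (ZMod p × ZMod p) → ℂ}
    (hx : adjOp (planeGenSet p b hb hinv).cayleyGraph x = μ • x) :
    ∃ y : G → ℂ, (∀ g k, x (g, k) = y g) ∧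
      ∀ g, ∑ h, ((p - 1) * b h : ℂ) * y (h * g) = μ * y g := by
  have hx' : ∀ g k, ∑ h, ∑ t ∈ lineUnion p (b h), x (h * g, .ofAdd (t + k)) =
      μ * x (g, .ofAdd k) := by
    intro g k
    rw [← adjOp_planeGenSet_apply (hb := hb) (hinv := hinv), hx, Pi.smul_apply, smul_eq_mul]
  have hF := sum_fourier_mul_translate (T := fun h => lineUnion p (b h))
    (x := fun g k => x (g, .ofAdd k)) hx'
  -- The Fourier coefficients at `ψ ≠ 0` satisfy a weighted translation equation on `G` with weights
  -- of modulus at most `p`, and `‖μ‖ > |G| p` forces them to vanish.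
  have h0 : ∀ g, ∀ ψ : AddChar (ZMod p × ZMod p) ℂ, ψ ≠ 0 →
      ∑ k, ψ k * x (g, .ofAdd k) = 0 := by
    intro g ψ hψ
    refine eq_zero_of_sum_mul_translate_eq (c := fun h => ∑ t ∈ lineUnion p (b h), ψ (-t))
      (fun h => ?_) hμ (y := fun g => ∑ k, ψ k * x (g, .ofAdd k)) (hF ψ) g
    have : ∀ t, ψ (-t) = ψ⁻¹ t := fun t => (AddChar.inv_apply ψ t).symm
    simp_rw [this]
    exact norm_sum_lineUnion_le (hbp h) (by
      intro e
      apply hψ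
      rw [← inv_inv ψ, e]
      ext t
      simp [AddChar.inv_apply])
  have hconst : ∀ g k, x (g, .ofAdd k) = x (g, .ofAdd 0) := by
    intro g k
    have hne : (Fintype.card (ZMod p × ZMod p) : ℂ) ≠ 0 := Nat.cast_ne_zero.2 Fintype.card_ne_zero
    have := card_mul_eq_sum_of_fourier_eq_zero (y := fun k => x (g, .ofAdd k)) (h0 g)
    exact mul_left_cancel₀ hne ((this k).trans (this 0).symm)
  refine ⟨fun g => x (g, .ofAdd 0), fun g k => hconst g k.toAdd, fun g => ?_⟩
  rw [← hx' g 0]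
  refine Finset.sum_congr rfl fun h _ => ?_
  rw [Finset.sum_congr rfl fun t _ => hconst (h * g) (t + 0), Finset.sum_const, nsmul_eq_mul,
    card_lineUnion (hbp h)]

lemma adjOp_planeGenSet_pullback (hbp : ∀ h, b h ≤ p) {μ : ℂ} {y : G → ℂ}
    (hy : ∀ g, ∑ h, ((p - 1) * b h : ℂ) * y (h * g) = μ * y g) :
    adjOp (planeGenSet p b hb hinv).cayleyGraph (fun s => y s.1) = μ • fun s => y s.1 := by
  ext ⟨g, k⟩
  rw [← ofAdd_toAdd k, adjOp_planeGenSet_apply, Pi.smul_apply, smul_eq_mul, ← hy g]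
  refine Finset.sum_congr rfl fun h _ => ?_
  simp only [Finset.sum_const, nsmul_eq_mul, card_lineUnion (hbp h)]

end PlaneExtension

/-! ### Weighted translation operators built from a tight frame -/

section Frame

variable {G ι : Type} [Fintype G] [Fintype ι] {u : G → ι → ℤ} {κ : ℤ}

/-- The weighted translation operator with weights `B + ⟨u h, u 1⟩`, where `u` is a centred tight
frame, acts on its `κ`-eigenspace through matrix coefficients. -/
lemma exists_eq_sum_frame_mul [Group G] {b : G → ℕ} {B : ℤ}
    (hbu : ∀ h g, (b (h * g⁻¹) : ℤ) = B + ∑ i, u h i * u g i)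
    (hzero : ∀ i, ∑ g, u g i = 0) (hκ : κ ≠ 0) (hB : κ ≠ B * Fintype.card G) {y : G → ℂ}
    (hy : ∀ g, ∑ h, (b h : ℂ) * y (h * g) = κ * y g) :
    ∃ w : ι → ℂ, ∀ g, y g = ∑ i, u g i * w i := by
  have hκ' : (κ : ℂ) ≠ 0 := by exact_mod_cast hκ
  have hbu' : ∀ h g, (b (h * g⁻¹) : ℂ) = B + ∑ i, (u h i : ℂ) * (u g i : ℂ) := by
    intro h g; exact_mod_cast congrArg (Int.cast : ℤ → ℂ) (hbu h g)
  have hy' : ∀ g, B * ∑ h, y h + ∑ i, u g i * ∑ h, u h i * y h = κ * y g := by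
    intro g
    rw [← hy g, ← Equiv.sum_comp (Equiv.mulRight g⁻¹) fun h => (b h : ℂ) * y (h * g)]
    simp only [Equiv.coe_mulRight, inv_mul_cancel_right, hbu', add_mul, Finset.sum_add_distrib,
      Finset.mul_sum, Finset.sum_mul]
    rw [Finset.sum_comm]
    congr 1
    refine Finset.sum_congr rfl fun h _ => Finset.sum_congr rfl fun i _ => ?_
    ring
  -- Summing the equation over `g` removes the centred frame part and leaves `B |G| ∑ y = κ ∑ y`.
  have hsum : ∑ h, y h = 0 := by
    have h1 := Finset.sum_congr (rfl : (Finset.univ : Finset G) = Finset.univ) fun g _ => hy' g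
    have hz : ∀ i, ∑ g, (u g i : ℂ) = 0 := by
      intro i; exact_mod_cast congrArg (Int.cast : ℤ → ℂ) (hzero i)
    have h0 : ∑ g, ∑ i, (u g i : ℂ) * ∑ h, u h i * y h = 0 := by
      rw [Finset.sum_comm]
      simp_rw [← Finset.sum_mul, hz, zero_mul, Finset.sum_const_zero]
    rw [Finset.sum_add_distrib, h0, ← Finset.mul_sum, ← Finset.mul_sum] at h1
    simp only [Finset.sum_const, Finset.card_univ, nsmul_eq_mul, add_zero] at h1
    have h2 : ((κ : ℂ) - B * Fintype.card G) * ∑ h, y h = 0 := by linear_combination -h1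
    refine (mul_eq_zero.1 h2).resolve_left ?_
    refine sub_ne_zero.2 ?_
    exact_mod_cast hB
  refine ⟨fun i => (∑ h, u h i * y h) / κ, fun g => ?_⟩
  have := hy' g
  rw [hsum, mul_zero, zero_add] at this
  rw [eq_comm, ← mul_right_inj' hκ', ← this, Finset.mul_sum]
  refine Finset.sum_congr rfl fun i _ => ?_
  field_simp

/-- Converse direction: the frame coordinates are themselves `κ`-eigenfunctions, so `κ` really
occurs as an eigenvalue. -/
lemma sum_mul_frame_translate [Group G] [DecidableEq ι] {b : G → ℕ} {B : ℤ}
    (hbu : ∀ h g, (b (h * g⁻¹) : ℤ) = B + ∑ i, u h i * u g i)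
    (hzero : ∀ i, ∑ g, u g i = 0)
    (horth : ∀ i j, ∑ g, u g i * u g j = if i = j then κ else 0) (j : ι) (g : G) :
    ∑ h, (b h : ℂ) * u (h * g) j = κ * u g j := by
  have : ∑ h, (b h : ℤ) * u (h * g) j = κ * u g j := by
    rw [← Equiv.sum_comp (Equiv.mulRight g⁻¹)]
    simp only [Equiv.coe_mulRight, inv_mul_cancel_right, hbu, add_mul, Finset.sum_add_distrib,
      Finset.sum_mul]
    rw [← Finset.mul_sum, hzero, mul_zero, zero_add, Finset.sum_comm]
    have : ∀ i, ∑ h, u h i * u g i * u h j = u g i * if i = j then κ else 0 := by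
      intro i
      rw [← horth, Finset.mul_sum]
      exact Finset.sum_congr rfl fun h _ => by ring
    rw [Finset.sum_congr rfl fun i _ => this i]
    simp [mul_comm]
  exact_mod_cast congrArg (Int.cast : ℤ → ℂ) this

/-- Parseval for the tight frame; this computes the `L²` norm of every eigenfunction from its
coefficient vector. -/
lemma sum_norm_sq_frame [DecidableEq ι]
    (horth : ∀ i j, ∑ g, u g i * u g j = if i = j then κ else 0)
    (w : ι → ℂ) : ∑ g, ‖∑ i, (u g i : ℂ) * w i‖ ^ 2 = κ * ∑ i, ‖w i‖ ^ 2 := by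
  have hC : (((∑ g, ‖∑ i, (u g i : ℂ) * w i‖ ^ 2 : ℝ)) : ℂ) = κ * ∑ i, ((‖w i‖ ^ 2 : ℝ) : ℂ) := by
    push_cast
    simp_rw [← Complex.conj_mul', map_sum, map_mul, Finset.sum_mul_sum, map_intCast]
    rw [Finset.sum_comm]
    have : ∀ i, ∑ g, ∑ j, (u g i : ℂ) * (starRingEnd ℂ) (w i) * (u g j * w j) =
        κ * ((starRingEnd ℂ) (w i) * w i) := by
      intro i
      rw [Finset.sum_comm]
      have h1 : ∀ j, ∑ g, (u g i : ℂ) * (starRingEnd ℂ) (w i) * (u g j * w j) =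
          (if i = j then (κ : ℂ) else 0) * ((starRingEnd ℂ) (w i) * w j) := by
        intro j
        have h2 : ∑ g, (u g i : ℂ) * u g j = if i = j then (κ : ℂ) else 0 := by
          have := congrArg (Int.cast : ℤ → ℂ) (horth i j)
          push_cast at this
          simpa using this
        rw [← h2, Finset.sum_mul]
        exact Finset.sum_congr rfl fun g _ => by ring
      simp [h1]
    rw [Finset.sum_congr rfl fun i _ => this i, Finset.mul_sum]
  exact_mod_cast hC

end Frame

/-! ### From a frame to a localized eigenspace -/

lemma le_normLinf {V : Type} [Finite V] (x : V → ℂ) (v : V) : ‖x v‖ ≤ normLinf x :=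
  le_ciSup (f := fun v => ‖x v‖) (Set.finite_range _).bddAbove v

/-- A centred tight frame which spreads out no coefficient vector gives a Cayley graph all of whose
eigenfunctions for a suitable eigenvalue are large somewhere. -/
theorem exists_localized_eigenspace {G ι : Type} [Group G] [Fintype G] [Fintype ι] [Nonempty ι]
    [DecidableEq ι] {u : G → ι → ℤ} {κ : ℤ} {p : ℕ} [Fact p.Prime] {b : G → ℕ} {B : ℤ}
    (hp : 3 ≤ p) (hb : ∀ h, 2 ≤ b h) (hbp : ∀ h, b h ≤ p)
    (hbu : ∀ h g, (b (h * g⁻¹) : ℤ) = B + ∑ i, u h i * u g i)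
    (hzero : ∀ i, ∑ g, u g i = 0)
    (horth : ∀ i j, ∑ g, u g i * u g j = if i = j then κ else 0)
    (hκ : 2 * (Fintype.card G : ℤ) ≤ κ) (hB : κ ≠ B * Fintype.card G) {L : ℝ}
    (hL : ∀ w : ι → ℂ, ∃ g, L * Real.sqrt (∑ i, ‖w i‖ ^ 2) ≤ ‖∑ i, (u g i : ℂ) * w i‖) :
    ∃ S : SymmGenSet (G × Multiplicative (ZMod p × ZMod p)), ∃ μ : ℂ,
      (adjOp S.cayleyGraph).HasEigenvalue μ ∧
      ∀ x ∈ (adjOp S.cayleyGraph).eigenspace μ,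
        L * normL2 x ≤ Real.sqrt (κ / Fintype.card G) * normLinf x := by
  have hcard : (0 : ℝ) < Fintype.card G := by exact_mod_cast Fintype.card_pos
  have hcardZ : (0 : ℤ) < Fintype.card G := by exact_mod_cast Fintype.card_pos
  have hκ0 : 0 < κ := by linarith
  have hκR : 2 * (Fintype.card G : ℝ) ≤ κ := by exact_mod_cast hκ
  have hκR0 : (0 : ℝ) < κ := by exact_mod_cast hκ0
  have hpR : (3 : ℝ) ≤ p := by exact_mod_cast hp
  have hp1 : ((p : ℂ) - 1) ≠ 0 := by
    rw [sub_ne_zero]; exact_mod_cast (by omega : p ≠ 1)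
  have hinv : ∀ h, b h⁻¹ = b h := by
    intro h
    have h1 := hbu 1 h
    have h2 := hbu h 1
    rw [one_mul] at h1
    rw [inv_one, mul_one] at h2
    simp_rw [mul_comm (u 1 _)] at h1
    exact_mod_cast h1.trans h2.symm
  set μ : ℂ := (p - 1) * κ with hμ
  -- Here `(p - 1) κ ≥ 2 (p - 1) |G| > p |G|` because `p ≥ 3`.
  have hμn : Fintype.card G * (p : ℝ) < ‖μ‖ := by
    have : μ = (((p - 1) * κ : ℝ) : ℂ) := by rw [hμ]; push_cast; ring
    rw [this, Complex.norm_real, Real.norm_of_nonneg (by nlinarith)]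
    nlinarith
  refine ⟨planeGenSet p b hb hinv, μ, ?_, ?_⟩
  · obtain ⟨j⟩ := ‹Nonempty ι›
    refine Module.End.hasEigenvalue_of_hasEigenvector (x := fun s => (u s.1 j : ℂ))
      ⟨Module.End.mem_eigenspace_iff.2 ?_, ?_⟩
    · refine adjOp_planeGenSet_pullback hbp (y := fun g => (u g j : ℂ)) fun g => ?_
      simp_rw [mul_assoc, ← Finset.mul_sum]
      rw [sum_mul_frame_translate hbu hzero horth, hμ, mul_assoc]
    · intro h0
      have h1 : ∀ g, u g j = 0 := fun g => by
        have := congrFun h0 (g, 1)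
        simpa using this
      have := horth j j
      simp only [h1, mul_zero, Finset.sum_const_zero, if_true] at this
      omega
  · intro x hx
    obtain ⟨y, hxy, hy⟩ := exists_eq_of_adjOp_planeGenSet_eq hbp hμn
      (Module.End.mem_eigenspace_iff.1 hx)
    have hy' : ∀ g, ∑ h, (b h : ℂ) * y (h * g) = κ * y g := by
      intro g
      have := hy g
      simp_rw [mul_assoc, ← Finset.mul_sum] at this
      rw [hμ, mul_assoc] at this
      exact mul_left_cancel₀ hp1 this
    obtain ⟨w, hw⟩ := exists_eq_sum_frame_mul hbu hzero hκ0.ne' hB hy'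
    have hL2 : normL2 x = Real.sqrt (κ / Fintype.card G) * Real.sqrt (∑ i, ‖w i‖ ^ 2) := by
      rw [normL2, ← Real.sqrt_mul (by positivity)]
      congr 1
      rw [Fintype.sum_prod_type, Fintype.card_prod]
      simp_rw [hxy, Finset.sum_const, hw, nsmul_eq_mul, ← Finset.mul_sum]
      rw [sum_norm_sq_frame horth, Finset.card_univ]
      have : ((Fintype.card (Multiplicative (ZMod p × ZMod p)) : ℕ) : ℝ) ≠ 0 :=
        Nat.cast_ne_zero.2 Fintype.card_ne_zero
      push_cast
      field_simp
    obtain ⟨g, hg⟩ := hL w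
    have h1 := hg.trans (by rw [← hw, ← hxy g 1])
    rw [hL2]
    calc _ = Real.sqrt (κ / Fintype.card G) * (L * Real.sqrt (∑ i, ‖w i‖ ^ 2)) := by ring
      _ ≤ _ := by gcongr; exact h1.trans (le_normLinf x (g, 1))

/-! ### Signed permutations and the orbit frame -/

/-- The group of signed permutations of `d` coordinates. -/
abbrev SignedPerm (d : ℕ) : Type :=
  (Fin d → ℤˣ) ⋊[mulAutArrow] Equiv.Perm (Fin d)

instance (d : ℕ) : Fintype (SignedPerm d) :=
  Fintype.ofEquiv _ SemidirectProduct.equivProd.symm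

namespace SignedPerm

variable {d : ℕ}

lemma card_eq (d : ℕ) : Fintype.card (SignedPerm d) = 2 ^ d * d.factorial := by
  rw [Fintype.card_congr SemidirectProduct.equivProd, Fintype.card_prod, Fintype.card_perm]
  simp

lemma perm_inv_apply_self {α : Type*} (σ : Equiv.Perm α) (i : α) : σ⁻¹ (σ i) = i :=
  σ.symm_apply_apply i

lemma mul_left_apply (g h : SignedPerm d) (i : Fin d) :
    (g * h).left i = g.left i * h.left (g.right⁻¹ i) := rfl

lemma inv_left_apply (g : SignedPerm d) (i : Fin d) :
    g⁻¹.left i = (g.left (g.right i))⁻¹ := rfl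

/-- The orbit `g ↦ g⁻¹ v` of an integer vector. -/
def orbit (v : Fin d → ℤ) (g : SignedPerm d) (j : Fin d) : ℤ :=
  (g.left (g.right j) : ℤ) * v (g.right j)

lemma orbit_mul_inl (v : Fin d → ℤ) (g : SignedPerm d) (η : Fin d → ℤˣ) (j : Fin d) :
    orbit v (g * .inl η) j = η j * orbit v g j := by
  simp only [orbit, mul_left_apply, SemidirectProduct.mul_right, SemidirectProduct.right_inl,
    SemidirectProduct.left_inl, mul_one, perm_inv_apply_self, Units.val_mul]
  ring

lemma orbit_mul_inr (v : Fin d → ℤ) (g : SignedPerm d) (σ : Equiv.Perm (Fin d)) (j : Fin d) :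
    orbit v (g * .inr σ) j = orbit v g (σ j) := by
  simp [orbit]

/-- Invariance of the inner product: `⟨g h⁻¹ v, v⟩ = ⟨h⁻¹ v, g⁻¹ v⟩`. This gives the weights the
kernel required of a frame. -/
lemma sum_orbit_mul_inv (v : Fin d → ℤ) (h g : SignedPerm d) :
    ∑ i, orbit v (h * g⁻¹) i * v i = ∑ i, orbit v h i * orbit v g i := by
  rw [← Equiv.sum_comp g.right]
  refine Finset.sum_congr rfl fun i _ => ?_
  simp only [orbit, mul_left_apply, inv_left_apply, SemidirectProduct.mul_right,
    SemidirectProduct.inv_right, Equiv.Perm.mul_apply, perm_inv_apply_self, Units.val_mul,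
    Int.units_inv_eq_self]
  ring

lemma orbit_sq (v : Fin d → ℤ) (g : SignedPerm d) (j : Fin d) :
    orbit v g j ^ 2 = v (g.right j) ^ 2 := by
  rw [orbit, mul_pow, ← Units.val_pow_eq_pow_val, Int.units_sq, Units.val_one, one_mul]

lemma sum_orbit_sq (v : Fin d → ℤ) (g : SignedPerm d) :
    ∑ j, orbit v g j ^ 2 = ∑ j, v j ^ 2 := by
  simp_rw [orbit_sq]
  exact Equiv.sum_comp g.right fun j => v j ^ 2

lemma sum_orbit (v : Fin d → ℤ) (j : Fin d) : ∑ g, orbit v g j = 0 := by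
  have := Equiv.sum_comp (Equiv.mulRight (.inl fun _ => -1 : SignedPerm d)) fun g => orbit v g j
  simp only [Equiv.coe_mulRight, orbit_mul_inl] at this
  rw [← Finset.mul_sum] at this
  push_cast at this
  linarith

/-- Flipping the sign of coordinate `j` permutes the group and negates the sum. -/
lemma sum_orbit_mul_orbit_of_ne (v : Fin d → ℤ) {i j : Fin d} (hij : i ≠ j) :
    ∑ g, orbit v g i * orbit v g j = 0 := by
  have := Equiv.sum_comp (Equiv.mulRight (.inl (Function.update 1 j (-1)) : SignedPerm d))
    fun g => orbit v g i * orbit v g j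
  simp only [Equiv.coe_mulRight, orbit_mul_inl, Function.update_self,
    Function.update_of_ne hij, Pi.one_apply, Units.val_one, Units.val_neg, one_mul, neg_mul,
    mul_neg, Finset.sum_neg_distrib] at this
  linarith

lemma sum_orbit_sq_eq (v : Fin d → ℤ) (i j : Fin d) :
    ∑ g, orbit v g i ^ 2 = ∑ g, orbit v g j ^ 2 := by
  have := Equiv.sum_comp (Equiv.mulRight (.inr (Equiv.swap i j) : SignedPerm d))
    fun g => orbit v g i ^ 2
  simpa [orbit_mul_inr] using this.symm

/-- By symmetry all coordinates have the same second moment, and signed permutations preserve `∑ v j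
^ 2`; this fixes the frame constant. -/
lemma card_mul_sum_orbit_sq (v : Fin d → ℤ) (i : Fin d) :
    d * ∑ g, orbit v g i ^ 2 = Fintype.card (SignedPerm d) * ∑ j, v j ^ 2 := by
  have h : ∑ j, ∑ g, orbit v g j ^ 2 = d * ∑ g, orbit v g i ^ 2 := by
    rw [Finset.sum_congr rfl fun j _ => sum_orbit_sq_eq v j i]
    simp
  rw [← h, Finset.sum_comm]
  simp_rw [sum_orbit_sq]
  simp

end SignedPerm

/-! ### The test vector and sorting -/

/-- An integer approximation, within a factor of two, to `k ↦ √(d / (k + 1))`. -/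
def invSqrtVec (d : ℕ) (k : Fin d) : ℤ := (Nat.sqrt (d / (k + 1)) + 1 : ℕ)

namespace invSqrtVec

variable {d : ℕ}

lemma le_mul_sq (k : Fin d) : (d : ℤ) ≤ (k + 1) * invSqrtVec d k ^ 2 := by
  have h1 : d / (k + 1) + 1 ≤ (Nat.sqrt (d / (k + 1)) + 1) ^ 2 := Nat.lt_succ_sqrt' _
  have h2 : d ≤ (k + 1) * (d / (k + 1) + 1) := (Nat.lt_mul_div_succ d (Nat.succ_pos k)).le
  have h3 := h2.trans (Nat.mul_le_mul_left (k + 1) h1)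
  rw [invSqrtVec]
  exact_mod_cast h3

lemma two_le (k : Fin d) : 2 ≤ invSqrtVec d k := by
  have h1 : 0 < d / (k + 1) := Nat.div_pos k.2 (Nat.succ_pos _)
  have h2 : 0 < Nat.sqrt (d / (k + 1)) := Nat.sqrt_pos.2 h1
  rw [invSqrtVec]
  exact_mod_cast (by omega : 2 ≤ Nat.sqrt (d / (k + 1)) + 1)

lemma mul_sq_le (k : Fin d) : (k + 1) * invSqrtVec d k ^ 2 ≤ (4 * d : ℤ) := by
  have h1 : 0 < d / (k + 1) := Nat.div_pos k.2 (Nat.succ_pos _)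
  have h2 : 0 < Nat.sqrt (d / (k + 1)) := Nat.sqrt_pos.2 h1
  have h3 : Nat.sqrt (d / (k + 1)) ^ 2 ≤ d / (k + 1) := Nat.sqrt_le' _
  have h4 : (k + 1) * (d / (k + 1)) ≤ d := Nat.mul_div_le _ _
  have h5 : (Nat.sqrt (d / (k + 1)) + 1) ^ 2 ≤ 4 * Nat.sqrt (d / (k + 1)) ^ 2 := by nlinarith
  have h6 : (k + 1) * (Nat.sqrt (d / (k + 1)) + 1) ^ 2 ≤ 4 * d :=
    calc _ ≤ (k + 1) * (4 * (d / (k + 1))) := Nat.mul_le_mul_left _ (h5.trans (by omega))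
      _ = 4 * ((k + 1) * (d / (k + 1))) := by ring
      _ ≤ _ := by omega
  rw [invSqrtVec]
  exact_mod_cast h6

lemma four_mul_le_sum_sq (d : ℕ) : (4 * d : ℤ) ≤ ∑ k, invSqrtVec d k ^ 2 := by
  calc (4 * d : ℤ) = ∑ _k : Fin d, 4 := by simp [mul_comm]
    _ ≤ _ := Finset.sum_le_sum fun k _ => by nlinarith [two_le k]

lemma sum_sq_le_sq (d : ℕ) : ∑ k, invSqrtVec d k ^ 2 ≤ (4 * d ^ 2 : ℤ) := by
  calc _ ≤ ∑ _k : Fin d, (4 * d : ℤ) := Finset.sum_le_sum fun k _ => by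
        have := mul_sq_le k
        nlinarith [sq_nonneg (invSqrtVec d k), Int.natCast_nonneg (k : ℕ)]
    _ = _ := by simp; ring

lemma sum_sq_le_log (d : ℕ) :
    ((∑ k, invSqrtVec d k ^ 2 : ℤ) : ℝ) ≤ 4 * d * (1 + Real.log d) := by
  push_cast
  calc ∑ k, (invSqrtVec d k : ℝ) ^ 2 ≤ ∑ k : Fin d, 4 * d * ((k : ℝ) + 1)⁻¹ := by
        refine Finset.sum_le_sum fun k _ => ?_
        rw [← div_eq_mul_inv, le_div_iff₀ (by positivity), mul_comm]
        exact_mod_cast mul_sq_le k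
    _ = 4 * d * (harmonic d : ℝ) := by
        rw [← Finset.mul_sum, harmonic, Fin.sum_univ_eq_sum_range (fun k => ((k : ℝ) + 1)⁻¹)]
        push_cast
        rfl
    _ ≤ _ := by
        gcongr
        exact harmonic_le_one_add_log d

end invSqrtVec

lemma succ_mul_sq_le_sum_sq {d : ℕ} {α : Fin d → ℝ} (hα : Antitone α) (h0 : ∀ k, 0 ≤ α k)
    (k : Fin d) : ((k : ℝ) + 1) * α k ^ 2 ≤ ∑ j, α j ^ 2 := by
  calc ((k : ℝ) + 1) * α k ^ 2 = ∑ _j ∈ Finset.Iic k, α k ^ 2 := by simp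
    _ ≤ ∑ j ∈ Finset.Iic k, α j ^ 2 := Finset.sum_le_sum fun j hj =>
        pow_le_pow_left₀ (h0 k) (hα (Finset.mem_Iic.1 hj)) 2
    _ ≤ _ := Finset.sum_le_sum_of_subset_of_nonneg (Finset.subset_univ _)
        fun j _ _ => sq_nonneg _

/-- Monotonicity gives `√(k+1) α k ≤ ‖α‖`, and `√(k+1) v k ≥ √d` for the test vector `v`. Hence `√d
(α k)² ≤ v k α k ‖α‖` term by term; sum over `k` and divide by `‖α‖`. -/
lemma sqrt_mul_sqrt_le_sum_invSqrtVec {d : ℕ} {α : Fin d → ℝ} (hα : Antitone α)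
    (h0 : ∀ k, 0 ≤ α k) :
    Real.sqrt d * Real.sqrt (∑ k, α k ^ 2) ≤ ∑ k, invSqrtVec d k * α k := by
  set s := ∑ k, α k ^ 2 with hs
  rcases (Real.sqrt_nonneg s).eq_or_lt with h | h
  · rw [← h, mul_zero]
    refine Finset.sum_nonneg fun k _ => mul_nonneg ?_ (h0 k)
    exact_mod_cast zero_le_two.trans (invSqrtVec.two_le k)
  have hs0 : 0 ≤ s := Finset.sum_nonneg fun k _ => sq_nonneg _
  refine le_of_mul_le_mul_right ?_ h
  rw [mul_assoc, Real.mul_self_sqrt hs0]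
  rw [hs, Finset.mul_sum, ← hs, Finset.sum_mul]
  refine Finset.sum_le_sum fun k _ => ?_
  have hv : (0 : ℝ) ≤ invSqrtVec d k := by
    exact_mod_cast zero_le_two.trans (invSqrtVec.two_le k)
  have h1 : Real.sqrt d ≤ Real.sqrt (k + 1) * invSqrtVec d k := by
    rw [← Real.sqrt_sq hv, ← Real.sqrt_mul (by positivity)]
    refine Real.sqrt_le_sqrt ?_
    exact_mod_cast invSqrtVec.le_mul_sq k
  have h2 : Real.sqrt (k + 1) * α k ≤ Real.sqrt s := by
    rw [← Real.sqrt_sq (h0 k), ← Real.sqrt_mul (by positivity)]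
    exact Real.sqrt_le_sqrt (succ_mul_sq_le_sum_sq hα h0 k)
  calc Real.sqrt d * α k ^ 2 ≤ (Real.sqrt (k + 1) * invSqrtVec d k) * α k ^ 2 := by gcongr
    _ = (invSqrtVec d k * α k) * (Real.sqrt (k + 1) * α k) := by ring
    _ ≤ _ := by
      have := mul_nonneg hv (h0 k)
      gcongr

/-- Sorting the coordinates: some element of the orbit correlates well with a given real vector. -/
lemma exists_sqrt_mul_le_sum_orbit {d : ℕ} (a : Fin d → ℝ) :
    ∃ g, Real.sqrt d * Real.sqrt (∑ i, a i ^ 2) ≤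
      ∑ i, (SignedPerm.orbit (invSqrtVec d) g i : ℝ) * a i := by
  set σ := Tuple.sort fun i => -|a i| with hσ
  have hα : Antitone fun k => |a (σ k)| := fun i j hij => by
    have := Tuple.monotone_sort (fun i => -|a i|) hij
    simpa using this
  -- The group element puts the entry of `invSqrtVec` indexed by the rank of `|a i|` at position
  -- `i`, with the sign of `a i`.
  refine ⟨⟨fun k => if a (σ k) < 0 then -1 else 1, σ⁻¹⟩, ?_⟩
  have h := sqrt_mul_sqrt_le_sum_invSqrtVec hα fun k => abs_nonneg _
  simp only [sq_abs] at h
  rw [Equiv.sum_comp σ fun i => a i ^ 2] at h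
  refine h.trans_eq ?_
  rw [← Equiv.sum_comp σ⁻¹]
  refine Finset.sum_congr rfl fun i _ => ?_
  have hi : σ (σ⁻¹ i) = i := σ.apply_symm_apply i
  simp only [SignedPerm.orbit, hi]
  split_ifs with h
  · simp [abs_of_neg h]
  · simp [abs_of_nonneg (not_lt.1 h)]

/-- The real or the imaginary part of `w` carries at least half of its squared norm, which costs the
factor `√2`. -/
lemma exists_sqrt_mul_le_norm_sum_orbit {d : ℕ} (w : Fin d → ℂ) :
    ∃ g, Real.sqrt (d / 2) * Real.sqrt (∑ i, ‖w i‖ ^ 2) ≤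
      ‖∑ i, (SignedPerm.orbit (invSqrtVec d) g i : ℂ) * w i‖ := by
  have key : ∀ a : Fin d → ℝ, ∑ i, ‖w i‖ ^ 2 ≤ 2 * ∑ i, a i ^ 2 →
      (∀ g, ∑ i, (SignedPerm.orbit (invSqrtVec d) g i : ℝ) * a i ≤
        ‖∑ i, (SignedPerm.orbit (invSqrtVec d) g i : ℂ) * w i‖) →
      ∃ g, Real.sqrt (d / 2) * Real.sqrt (∑ i, ‖w i‖ ^ 2) ≤
        ‖∑ i, (SignedPerm.orbit (invSqrtVec d) g i : ℂ) * w i‖ := by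
    intro a ha hw
    obtain ⟨g, hg⟩ := exists_sqrt_mul_le_sum_orbit a
    refine ⟨g, le_trans ?_ (hg.trans (hw g))⟩
    rw [← Real.sqrt_mul (by positivity), ← Real.sqrt_mul (by positivity)]
    refine Real.sqrt_le_sqrt ?_
    have hd : (0 : ℝ) ≤ d := by positivity
    nlinarith
  have hsplit : ∑ i, ‖w i‖ ^ 2 = ∑ i, (w i).re ^ 2 + ∑ i, (w i).im ^ 2 := by
    rw [← Finset.sum_add_distrib]
    refine Finset.sum_congr rfl fun i _ => ?_
    rw [Complex.sq_norm, Complex.normSq_apply]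
    ring
  rcases le_total (∑ i, (w i).re ^ 2) (∑ i, (w i).im ^ 2) with h | h
  · refine key (fun i => (w i).im) (by linarith) fun g => ?_
    refine le_trans (le_of_eq ?_) ((le_abs_self _).trans (Complex.abs_im_le_norm _))
    simp
  · refine key (fun i => (w i).re) (by linarith) fun g => ?_
    refine le_trans (le_of_eq ?_) ((le_abs_self _).trans (Complex.abs_re_le_norm _))
    simp

theorem exists_localized_eigenspace_signedPerm {d p : ℕ} [Fact p.Prime] (hd : 0 < d)
    (hp : 8 * d ^ 2 + 2 ≤ p) :
    ∃ S : SymmGenSet (SignedPerm d × Multiplicative (ZMod p × ZMod p)), ∃ μ : ℂ,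
      (adjOp S.cayleyGraph).HasEigenvalue μ ∧
      ∀ x ∈ (adjOp S.cayleyGraph).eigenspace μ,
        Real.sqrt (d / 2) * normL2 x ≤ Real.sqrt (4 * (1 + Real.log d)) * normLinf x := by
  set v := invSqrtVec d
  set N := ∑ k, v k ^ 2 with hN
  have : Nonempty (Fin d) := ⟨⟨0, hd⟩⟩
  have hN1 : (4 * d : ℤ) ≤ N := invSqrtVec.four_mul_le_sum_sq d
  have hN2 : N ≤ (4 * d ^ 2 : ℤ) := invSqrtVec.sum_sq_le_sq d
  have hN3 : (N : ℝ) ≤ 4 * d * (1 + Real.log d) := invSqrtVec.sum_sq_le_log d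
  set f : SignedPerm d → ℤ := fun h => ∑ i, SignedPerm.orbit v h i * v i with hf
  have hf1 : ∀ h, -N ≤ f h := fun h => by
    have h1 : 0 ≤ ∑ i, (SignedPerm.orbit v h i + v i) ^ 2 :=
      Finset.sum_nonneg fun i _ => sq_nonneg _
    have h2 : ∑ i, (SignedPerm.orbit v h i + v i) ^ 2 = N + 2 * f h + N := by
      simp only [add_sq, Finset.sum_add_distrib, SignedPerm.sum_orbit_sq, hf, hN, Finset.mul_sum,
        mul_assoc]
    linarith
  have hf2 : ∀ h, f h ≤ N := fun h => by
    have h1 : 0 ≤ ∑ i, (SignedPerm.orbit v h i - v i) ^ 2 :=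
      Finset.sum_nonneg fun i _ => sq_nonneg _
    have h2 : ∑ i, (SignedPerm.orbit v h i - v i) ^ 2 = N - 2 * f h + N := by
      simp only [sub_sq, Finset.sum_add_distrib, Finset.sum_sub_distrib, SignedPerm.sum_orbit_sq,
        hf, hN, Finset.mul_sum, mul_assoc]
    linarith
  -- As `-N ≤ f ≤ N`, the shift `N + 2` puts `b` between `2`, needed for generation, and `2N + 2 ≤
  -- 8d² + 2 ≤ p`, the number of slopes available.
  set b : SignedPerm d → ℕ := fun h => (N + 2 + f h).toNat
  have hb : ∀ h, (b h : ℤ) = N + 2 + f h := fun h =>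
    Int.toNat_of_nonneg (by have := hf1 h; linarith)
  have hpZ : (8 * d ^ 2 + 2 : ℤ) ≤ p := by exact_mod_cast hp
  set κ := ∑ g, SignedPerm.orbit v g ⟨0, hd⟩ ^ 2 with hκdef
  have hdκ : d * κ = Fintype.card (SignedPerm d) * N := SignedPerm.card_mul_sum_orbit_sq v _
  have hdZ : (0 : ℤ) < d := by exact_mod_cast hd
  have hdR : (0 : ℝ) < d := by exact_mod_cast hd
  have hG : (0 : ℤ) < Fintype.card (SignedPerm d) := by exact_mod_cast Fintype.card_pos
  have hGR : (0 : ℝ) < Fintype.card (SignedPerm d) := by exact_mod_cast Fintype.card_pos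
  obtain ⟨S, μ, hμ, hS⟩ := exists_localized_eigenspace (u := SignedPerm.orbit v) (κ := κ) (p := p)
    (b := b) (B := N + 2) (L := Real.sqrt (d / 2)) (by nlinarith)
    (fun h => by zify; rw [hb]; linarith [hf1 h])
    (fun h => by zify; rw [hb]; linarith [hf2 h])
    (fun h g => by rw [hb, hf]; simp only [SignedPerm.sum_orbit_mul_inv])
    (SignedPerm.sum_orbit v)
    (fun i j => by
      split_ifs with hij
      · subst hij
        rw [hκdef, ← SignedPerm.sum_orbit_sq_eq v i]
        simp_rw [sq]
      · exact SignedPerm.sum_orbit_mul_orbit_of_ne v hij)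
    -- The frame constant is `κ = |G| N / d`. It is at least `4 |G|` since `N ≥ 4d`, and equality
    -- with `(N + 2) |G|` would give `d (N + 2) = N`.
    (by nlinarith) (fun e => by
      rw [e] at hdκ
      have h1 : d * (N + 2) = N := mul_left_cancel₀ hG.ne' (by linear_combination hdκ)
      nlinarith)
    exists_sqrt_mul_le_norm_sum_orbit
  refine ⟨S, μ, hμ, fun x hx => (hS x hx).trans ?_⟩
  have hx0 : 0 ≤ normLinf x := (norm_nonneg _).trans (le_normLinf x 1)
  gcongr
  have hdκR : (d : ℝ) * κ = Fintype.card (SignedPerm d) * N := by exact_mod_cast hdκ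
  rw [div_le_iff₀ hGR]
  refine le_of_mul_le_mul_left ?_ hdR
  rw [hdκR]
  nlinarith

/-! ### Eigenbases and the choice of the prime -/

lemma avgInner_self {V : Type} [Fintype V] (x : V → ℂ) : avgInner x x = (normL2 x ^ 2 : ℝ) := by
  rw [normL2, Real.sq_sqrt (by positivity), avgInner]
  push_cast
  congr 1
  exact Finset.sum_congr rfl fun v _ => Complex.conj_mul' _

/-- A basis of eigenvectors meets every eigenspace. -/
lemma exists_basis_mem_eigenspace {ι V : Type*} [AddCommGroup V] [Module ℂ V]
    {T : Module.End ℂ V} (b : Module.Basis ι ℂ V) (hb : ∀ i, ∃ μ, T.HasEigenvector μ (b i)) {μ : ℂ}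
    (hμ : T.HasEigenvalue μ) : ∃ i, b i ∈ T.eigenspace μ := by
  choose ν hν using hb
  obtain ⟨x, hx⟩ := hμ.exists_hasEigenvector
  have hne : b.repr x ≠ 0 := by simpa using hx.2
  obtain ⟨i, hi⟩ := Finsupp.ne_iff.1 hne
  -- Comparing `i`-th coordinates of `T x = μ • x` gives `μ = ν i` wherever the coordinate of `x` is
  -- nonzero.
  have hcoord : b.coord i ∘ₗ T = ν i • b.coord i := by
    classical
    refine b.ext fun j => ?_
    simp only [LinearMap.comp_apply, (hν j).apply_eq_smul, map_smul, Module.Basis.coord_apply,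
      Module.Basis.repr_self, LinearMap.smul_apply, smul_eq_mul, Finsupp.single_apply]
    split_ifs with h
    · rw [h]
    · simp
  have h := LinearMap.congr_fun hcoord x
  simp only [LinearMap.comp_apply, hx.apply_eq_smul, map_smul, Module.Basis.coord_apply,
    LinearMap.smul_apply, smul_eq_mul] at h
  refine ⟨i, ?_⟩
  rw [mul_right_cancel₀ hi h]
  exact (hν i).1

theorem exists_card_and_localized_eigenspace {d : ℕ} (hd : 0 < d) :
    ∃ p : ℕ, 8 * d ^ 2 + 2 < p ∧ p ≤ 2 * (8 * d ^ 2 + 2) ∧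
      ∃ (Γ : Type) (_ : Group Γ) (_ : Fintype Γ) (S : SymmGenSet Γ),
        Fintype.card Γ = 2 ^ d * d.factorial * p ^ 2 ∧
        ∃ μ : ℂ, (adjOp S.cayleyGraph).HasEigenvalue μ ∧
          ∀ x ∈ (adjOp S.cayleyGraph).eigenspace μ,
            Real.sqrt (d / 2) * normL2 x ≤ Real.sqrt (4 * (1 + Real.log d)) * normLinf x := by
  obtain ⟨p, hp, hp1, hp2⟩ := Nat.exists_prime_lt_and_le_two_mul (8 * d ^ 2 + 2) (by omega)
  have : Fact p.Prime := ⟨hp⟩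
  obtain ⟨S, μ, hμ, hS⟩ := exists_localized_eigenspace_signedPerm hd hp1.le
  refine ⟨p, hp1, hp2, _, _, _, S, ?_, μ, hμ, hS⟩
  rw [Fintype.card_prod, SignedPerm.card_eq, Fintype.card_congr Multiplicative.toAdd,
    Fintype.card_prod, ZMod.card, sq]

/-! ### Size of the group against the dimension `d` -/

lemma four_pow_le_card {d p : ℕ} (hp : 2 ≤ p) : 4 ^ d ≤ 2 ^ d * d.factorial * p ^ 2 := by
  have h : ∀ m : ℕ, 2 ^ m ≤ 2 * m.factorial := by
    intro m
    induction m with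
    | zero => simp
    | succ k ih =>
      rcases k.eq_zero_or_pos with rfl | hk
      · simp
      · rw [pow_succ, Nat.factorial_succ]
        nlinarith [k.factorial_pos]
  calc 4 ^ d = 2 ^ d * 2 ^ d := by rw [← mul_pow]; norm_num
    _ ≤ 2 ^ d * (2 * d.factorial) := Nat.mul_le_mul_left _ (h d)
    _ ≤ 2 ^ d * (p ^ 2 * d.factorial) := by gcongr; nlinarith
    _ = _ := by ring

lemma half_lt_log_natCast {d : ℕ} (hd : 2 ≤ d) : 1 / 2 < Real.log d := by
  have h1 : Real.log 2 ≤ Real.log d := Real.log_le_log (by norm_num) (by exact_mod_cast hd)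
  linarith [Real.log_two_gt_d9]

lemma natCast_le_log_card {d p : ℕ} (hp : 2 ≤ p) :
    (d : ℝ) ≤ Real.log (2 ^ d * d.factorial * p ^ 2 : ℕ) := by
  have h1 : Real.log (4 ^ d : ℕ) ≤ Real.log (2 ^ d * d.factorial * p ^ 2 : ℕ) :=
    Real.log_le_log (by positivity) (by exact_mod_cast four_pow_le_card hp)
  have h2 : Real.log (4 ^ d : ℕ) = d * (2 * Real.log 2) := by
    push_cast
    rw [Real.log_pow, show (4 : ℝ) = 2 ^ 2 by norm_num, Real.log_pow]
    norm_num
  have hd : (0 : ℝ) ≤ d := by positivity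
  nlinarith [Real.log_two_gt_d9]

/-- The three factors contribute at most `d log d`, `d log d` and `14 log d ≤ 7 d log d`, the last
because `p ≤ d^7`. -/
lemma log_card_le {d p : ℕ} (hd : 2 ≤ d) (hp0 : 0 < p) (hp : p ≤ 2 * (8 * d ^ 2 + 2)) :
    Real.log (2 ^ d * d.factorial * p ^ 2 : ℕ) ≤ 9 * (d * Real.log d) := by
  have hdR : (2 : ℝ) ≤ d := by exact_mod_cast hd
  have hlog := half_lt_log_natCast hd
  have hp7 : p ≤ d ^ 7 := by
    have : 2 ^ 5 ≤ d ^ 5 := Nat.pow_le_pow_left hd 5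
    calc p ≤ 2 ^ 5 * d ^ 2 := by nlinarith
      _ ≤ d ^ 5 * d ^ 2 := Nat.mul_le_mul_right _ this
      _ = d ^ 7 := by ring
  have h1 : Real.log p ≤ 7 * Real.log d := by
    calc Real.log p ≤ Real.log (d ^ 7 : ℕ) :=
          Real.log_le_log (by exact_mod_cast hp0) (by exact_mod_cast hp7)
      _ = _ := by push_cast; rw [Real.log_pow]; norm_num
  have h2 : Real.log d.factorial ≤ d * Real.log d := by
    calc Real.log d.factorial ≤ Real.log (d ^ d : ℕ) :=
          Real.log_le_log (by positivity) (by exact_mod_cast Nat.factorial_le_pow d)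
      _ = _ := by push_cast; rw [Real.log_pow]
  have h3 : Real.log 2 ≤ Real.log d := Real.log_le_log (by norm_num) hdR
  have hpR : (p : ℝ) ≠ 0 := by positivity
  push_cast
  rw [Real.log_mul (by positivity) (by positivity), Real.log_mul (by positivity) (by positivity),
    Real.log_pow, Real.log_pow]
  push_cast
  nlinarith

lemma sqrt_log_div_log_log_card_le {d p : ℕ} (hd : 2 ≤ d) (hp2 : 2 ≤ p)
    (hp : p ≤ 2 * (8 * d ^ 2 + 2)) {n : ℕ} (hn : n = 2 ^ d * d.factorial * p ^ 2) :
    Real.sqrt (4 * (1 + Real.log d)) * (1 / 15 * Real.sqrt (Real.log n)) ≤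
      Real.sqrt (d / 2) * Real.log (Real.log n) := by
  have hdR : (2 : ℝ) ≤ d := by exact_mod_cast hd
  have hlog := half_lt_log_natCast hd
  have h1 := natCast_le_log_card (d := d) hp2
  have h2 := log_card_le hd (by omega) hp
  rw [← hn] at h1 h2
  have h3 : Real.log d ≤ Real.log (Real.log n) := Real.log_le_log (by linarith) h1
  -- Since `log d > 1/2`, `1 + log d ≤ 3 log d`. The product of the radicands is then `108 d (log
  -- d)² = 216 (d/2) (log d)²`, and `216 ≤ 15²` explains the constant `1/15`.
  calc Real.sqrt (4 * (1 + Real.log d)) * (1 / 15 * Real.sqrt (Real.log n))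
      ≤ Real.sqrt (4 * (3 * Real.log d)) * (1 / 15 * Real.sqrt (9 * (d * Real.log d))) := by
        gcongr
        linarith
    _ = 1 / 15 * Real.sqrt (216 * (d / 2) * Real.log d ^ 2) := by
        rw [mul_left_comm, ← Real.sqrt_mul (by linarith)]
        congr 2
        ring
    _ ≤ 1 / 15 * Real.sqrt (15 ^ 2 * (d / 2) * Real.log d ^ 2) := by
        gcongr
        norm_num
    _ = Real.sqrt (d / 2) * Real.log d := by
        rw [Real.sqrt_mul (by positivity), Real.sqrt_mul (by positivity),
          Real.sqrt_sq (by norm_num), Real.sqrt_sq (by linarith)]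
        ring
    _ ≤ _ := by gcongr

lemma exists_mul_sqrt_log_lt_sqrt (C : ℝ) :
    ∃ d : ℕ, 0 < d ∧ Real.sqrt (4 * (1 + Real.log d)) * C < Real.sqrt (d / 2) := by
  -- Chosen so that `16 C² < √d`; with `1 + log d ≤ 2√d` this gives `4 (1 + log d) C² ≤ 8 C² √d <
  -- d/2`.
  obtain ⟨d, hd⟩ := exists_nat_gt ((16 * C ^ 2 + 1) ^ 2)
  have hd0 : (0 : ℝ) < d := lt_of_le_of_lt (sq_nonneg _) hd
  have hs : 16 * C ^ 2 + 1 < Real.sqrt d := Real.lt_sqrt_of_sq_lt hd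
  have hsq : Real.sqrt d ^ 2 = d := Real.sq_sqrt hd0.le
  have hlog : 1 + Real.log d ≤ 2 * Real.sqrt d := by
    have h := Real.log_le_sub_one_of_pos (Real.sqrt_pos.2 hd0)
    rw [Real.log_sqrt hd0.le] at h
    linarith
  refine ⟨d, by exact_mod_cast hd0, Real.lt_sqrt_of_sq_lt ?_⟩
  have hlog0 : 0 ≤ Real.log d := Real.log_natCast_nonneg d
  rw [mul_pow, Real.sq_sqrt (by linarith)]
  nlinarith [sq_nonneg C, Real.sqrt_nonneg d]

/-! ### The main theorem -/

theorem theorem1p2 :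
    (∃ c : ℝ, 0 < c ∧
      {n : ℕ | ∃ (Γ : Type) (_ : Group Γ) (_ : Fintype Γ) (S : SymmGenSet Γ),
        Fintype.card Γ = n ∧
        ∃ μ : ℂ, (adjOp S.cayleyGraph).HasEigenvalue μ ∧
          ∀ x ∈ (adjOp S.cayleyGraph).eigenspace μ,
            c * normL2 x * Real.sqrt (Real.log n) / Real.log (Real.log n)
              ≤ normLinf x}.Infinite) ∧
    (∀ C : ℝ, ∃ (Γ : Type) (_ : Group Γ) (_ : Fintype Γ) (S : SymmGenSet Γ),
      ¬ HasBoundedEigenbasis S.cayleyGraph C) := by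
  refine ⟨⟨1 / 15, by norm_num, ?_⟩, fun C => ?_⟩
  · refine Set.infinite_of_forall_exists_gt fun m => ?_
    have hd : 2 ≤ m + 2 := by omega
    obtain ⟨p, hp1, hp2, Γ, _, _, S, hcard, μ, hμ, hS⟩ :=
      exists_card_and_localized_eigenspace (d := m + 2) (by omega)
    set n := Fintype.card Γ with hn
    have hlarge : m + 2 < n := by
      rw [hcard]
      exact (Nat.lt_pow_self (by norm_num)).trans_le (four_pow_le_card (by omega))
    refine ⟨n, ⟨Γ, _, _, S, hn.symm, μ, hμ, fun x hx => ?_⟩, by omega⟩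
    have hbound := sqrt_log_div_log_log_card_le hd (by omega) hp2 hcard
    have hloglog : 0 < Real.log (Real.log n) := by
      have h1 := natCast_le_log_card (d := m + 2) (p := p) (by omega)
      rw [← hcard] at h1
      have h2 : (2 : ℝ) ≤ (m + 2 : ℕ) := by exact_mod_cast hd
      exact Real.log_pos (by linarith)
    have hL2 : 0 ≤ normL2 x := Real.sqrt_nonneg _
    have hD : 0 < Real.sqrt (4 * (1 + Real.log (m + 2 : ℕ))) :=
      Real.sqrt_pos.2 (by have := half_lt_log_natCast hd; linarith)
    rw [div_le_iff₀ hloglog]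
    refine le_of_mul_le_mul_left ?_ hD
    have h1 := mul_le_mul_of_nonneg_left hbound hL2
    have h2 := mul_le_mul_of_nonneg_right (hS x hx) hloglog.le
    linarith
  · obtain ⟨d, hd, hdC⟩ := exists_mul_sqrt_log_lt_sqrt C
    obtain ⟨p, -, -, Γ, instGroup, instFintype, S, -, μ, hμ, hS⟩ := exists_card_and_localized_eigenspace hd
    refine ⟨Γ, instGroup, instFintype, S, ?_⟩
    rintro ⟨b, hnorm, -, heig, hbdd⟩
    obtain ⟨i, hi⟩ := exists_basis_mem_eigenspace b heig hμ
    have h1 : normL2 (b i) ^ 2 = 1 := by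
      have := hnorm i
      rw [avgInner_self] at this
      exact_mod_cast this
    have h2 : normL2 (b i) = 1 :=
      (pow_eq_one_iff_of_nonneg (Real.sqrt_nonneg _) two_ne_zero).1 h1
    have h3 := hS _ hi
    rw [h2, mul_one] at h3
    have h4 := mul_le_mul_of_nonneg_left (hbdd i) (Real.sqrt_nonneg (4 * (1 + Real.log d)))
    linarith
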